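/- Let $k$ be a field, let $r\ge 1$ and $d\ge 1$ be integers, and let $V_d$ be a $k$-vector space with basis $e_1,\dots,e_d$. For $n\ge 0$, index the factors of $V_d^{\otimes\binom{n}{r}}$ by the $r$-element subsets of $\{1,\dots,n\}$, and let $\Lambda_{V_d}^{S^r}[n]$ be the quotient of $V_d^{\otimes\binom{n}{r}}$ by the subspace spanned by all simple tensors $\otimes_{I}v_I$ for which there is an $(r+1)$-element subset $X\subseteq\{1,\dots,n\}$ such that the vectors $v_I$, for all $r$-element subsets $I\subset X$, are equal. Let $det^{S^r}:V_d^{\otimes\binom{rd}{r}}\to k$ be the linear map whose value on a simple tensor $\otimes_I v_I$ is the determinant of the following square linear system in the $\binom{rd}{r}$ unknowns $\lambda_I$ ($I\subseteq\{1,\dots,rd\}$, $|I|=r$): for each $(r-1)$-element subset $F$ of $\{1,\dots,rd-1\}$, the vector equation $$\sum_{I}[F:I]\,\lambda_I v_I=0\in V_d ,$$ written as $d$ scalar equations in the coordinates with respect to $e_1,\dots,e_d$. Here $[F:I]=(-1)^{t-1}$ if $I=\{a_1<\dots<a_r\}$ and $F=I\setminus\{a_t\}$, and $[F:I]=0$ if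 $F\not\subset I$. (The number of equations is $d\binom{rd-1}{r-1}=\binom{rd}{r}$. Equations and unknowns are put in a fixed order; another order changes $det^{S^r}$ at most by a sign.) Then: 1. $det^{S^r}(\otimes_I v_I)=0$ whenever there is an $(r+1)$-element subset $X\subseteq\{1,\dots,rd\}$ such that the vectors $v_I$, for all $r$-element subsets $I\subset X$, are equal. 2. $det^{S^r}$ is nontrivial, i.e. it is not the zero map. 3. In particular, $\dim_k\big(\Lambda_{V_d}^{S^r}[rd]\big)\ge 1$. -/

import Mathlib

open scoped TensorProduct

noncomputable section

namespace DetSr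

/-- The `s`-element subsets of the vertex set `{0, …, n - 1}`, i.e. the hyperedges of the
`s`-uniform complete hypergraph on `n` vertices. A hyperedge stands for the increasing
sequence `i₁ < ⋯ < iₛ` of its elements. -/
abbrev Hyperedge (n s : ℕ) : Type := {I : Finset (Fin n) // I.card = s}

/-- The component `T[n] = V^{⊗ (n choose r)}`, with tensor factors indexed by `r`-subsets. -/
abbrev TensorSpace (k : Type*) [Field k] (V : Type*) [AddCommGroup V] [Module k V]
    (r n : ℕ) : Type _ :=
  ⨂[k] _ : Hyperedge n r, V

/-- There are `x₁ < ⋯ < x_{r+1}` such that the vectors attached to all the `r`-element subsets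
of `{x₁, …, x_{r+1}}` are equal. -/
def HasConstantSimplex {V : Type*} {r n : ℕ} (v : Hyperedge n r → V) : Prop :=
  ∃ X : Finset (Fin n), X.card = r + 1 ∧
    ∀ I J : Hyperedge n r, I.1 ⊆ X → J.1 ⊆ X → v I = v J

/-- The subspace of `T[n]` spanned by the simple tensors with a constant simplex. -/
def relations (k : Type*) [Field k] (V : Type*) [AddCommGroup V] [Module k V] (r n : ℕ) :
    Submodule k (TensorSpace k V r n) :=
  Submodule.span k {z | ∃ v : Hyperedge n r → V,
    HasConstantSimplex v ∧ z = PiTensorProduct.tprod k v}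

/-- The component `Λ_V^{S^r}[n]` of the exterior-algebra-like construction. -/
abbrev ExteriorS (k : Type*) [Field k] (V : Type*) [AddCommGroup V] [Module k V] (r n : ℕ) :
    Type _ :=
  TensorSpace k V r n ⧸ relations k V r n

/-- The coefficient of `[F]` in the simplicial boundary
`∂[a₁, …, aᵣ] = ∑ₜ (-1)^{t-1} [a₁, …, âₜ, …, aᵣ]` of the simplex `[I]`. -/
def boundaryCoeff (k : Type*) [Field k] {n : ℕ} (I F : Finset (Fin n)) : k :=
  ∑ i ∈ I, if I.erase i = F then (-1) ^ (I.filter (· < i)).card else 0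

/-- A face that avoids the last of `n` vertices, as a face on all `n` vertices. -/
def liftFace {n s : ℕ} (F : Hyperedge (n - 1) s) : Finset (Fin n) :=
  F.1.map (Fin.castLEEmb (Nat.sub_le n 1))

/-- The scalar equations of the linear system below: an `(r-1)`-face that avoids the last
vertex, and a coordinate in `V_d`. -/
abbrev EquationIndex (r d : ℕ) : Type := Hyperedge (r * d - 1) (r - 1) × Fin d

/-- The linear system in the unknowns `λ_I`, one for each `r`-subset `I` of the `r * d` vertices.
It consists of the vector equations `∑_I [F : ∂I] λ_I v_I = 0` in `V_d`, for all `(r-1)`-subsets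
`F` that do not contain the last vertex, written in the coordinates of a basis. The equations of
the other faces `F` are consequences of these (because `∂ ∘ ∂ = 0`). -/
def systemMatrix {k V : Type*} [Field k] [AddCommGroup V] [Module k V] {r d : ℕ}
    (b : Module.Basis (Fin d) k V) (v : Hyperedge (r * d) r → V) :
    Matrix (EquationIndex r d) (Hyperedge (r * d) r) k :=
  Matrix.of fun p I => boundaryCoeff k I.1 (liftFace p.1) * b.repr (v I) p.2

theorem card_hyperedge (n s : ℕ) : Fintype.card (Hyperedge n s) = n.choose s := by
  simp [Hyperedge, Fintype.card_finset_len]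

theorem choose_eq {r d : ℕ} (hr : 1 ≤ r) :
    (r * d - 1).choose (r - 1) * d = (r * d).choose r := by
  obtain ⟨q, rfl⟩ : ∃ q, r = q + 1 := ⟨r - 1, by omega⟩
  rcases Nat.eq_zero_or_pos d with rfl | hd
  · simp
  · obtain ⟨m, hm⟩ : ∃ m, (q + 1) * d = m + 1 :=
      ⟨(q + 1) * d - 1, (Nat.sub_add_cancel (Nat.mul_pos (Nat.succ_pos q) hd)).symm⟩
    have h := Nat.add_one_mul_choose_eq m q
    rw [← hm] at h
    simp only [hm, Nat.add_sub_cancel]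
    rw [← hm]
    apply Nat.eq_of_mul_eq_mul_right (Nat.succ_pos q)
    rw [← h]
    simp only [Nat.succ_eq_add_one]
    ring

/-- The colexicographic enumeration of the `s`-subsets of `{0, …, n - 1}`. -/
def hyperedgeOrder (n s : ℕ) : Hyperedge n s ≃ Fin (n.choose s) :=
  let e : Hyperedge n s ≃ {I : Colex (Finset (Fin n)) // (ofColex I).card = s} :=
    toColex.subtypeEquiv fun _ => Iff.rfl
  letI : Fintype {I : Colex (Finset (Fin n)) // (ofColex I).card = s} := Fintype.ofEquiv _ e
  e.trans (monoEquivOfFin {I : Colex (Finset (Fin n)) // (ofColex I).card = s}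
    ((Fintype.card_congr e).symm.trans (card_hyperedge n s))).symm.toEquiv

/-- The system is square: the equations, ordered face by face, are matched with the unknowns.
Another choice of the orders changes the determinant of the system at most by a sign. -/
def equationEquiv {r : ℕ} (d : ℕ) (hr : 1 ≤ r) :
    EquationIndex r d ≃ Hyperedge (r * d) r :=
  ((((hyperedgeOrder (r * d - 1) (r - 1)).prodCongr (Equiv.refl (Fin d))).trans
    finProdFinEquiv).trans (finCongr (choose_eq hr))).trans (hyperedgeOrder (r * d) r).symm

/-- The column of the system that belongs to the unknown `λ_I`, as a linear function of the
vector `v_I`. -/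
def columnMap {k V : Type*} [Field k] [AddCommGroup V] [Module k V] {r d : ℕ} (hr : 1 ≤ r)
    (b : Module.Basis (Fin d) k V) (I : Hyperedge (r * d) r) :
    V →ₗ[k] (Hyperedge (r * d) r → k) :=
  LinearMap.pi fun J =>
    boundaryCoeff k I.1 (liftFace ((equationEquiv d hr).symm J).1) •
      b.coord ((equationEquiv d hr).symm J).2

/-- The linear map `det^{S^r} : V_d^{⊗ (rd choose r)} → k`: on a simple tensor it is the
determinant of the linear system above (see `detS_tprod`). -/
def detS {k V : Type*} [Field k] [AddCommGroup V] [Module k V] {r d : ℕ} (hr : 1 ≤ r)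
    (b : Module.Basis (Fin d) k V) : TensorSpace k V r (r * d) →ₗ[k] k :=
  PiTensorProduct.lift
    ((Matrix.detRowAlternating (n := Hyperedge (r * d) r)
      (R := k)).toMultilinearMap.compLinearMap (columnMap hr b))

theorem detS_tprod {k V : Type*} [Field k] [AddCommGroup V] [Module k V] {r d : ℕ}
    (hr : 1 ≤ r) (b : Module.Basis (Fin d) k V) (v : Hyperedge (r * d) r → V) :
    detS hr b (PiTensorProduct.tprod k v) =
      ((systemMatrix b v).submatrix (equationEquiv d hr).symm id).det := by
  rw [detS, PiTensorProduct.lift.tprod, ← Matrix.det_transpose]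
  rfl

end DetSr

end

/-!
Write `∂I` for the simplicial boundary of the simplex on `I`, and `n = r * d`.

Vanishing: if all `r`-subsets of an `(r + 1)`-set `X` carry the same vector, the coefficients of
`∂X` are a nonzero solution of the linear system, because `∂ ∘ ∂ = 0` (`boundaryCoeff_comp`).

Nontriviality: it suffices to partition the `r`-subsets of the vertices into `d` classes, each with
linearly independent boundaries. Attach the `i`-th basis vector to the members of the `i`-th class.
A solution of the system then restricts on each class to a chain whose boundary vanishes on the
faces that avoid the last vertex; such a boundary, being a cycle, is zero (`eq_zero_of_cycle`), so
the solution is zero (`detS_tprod_basis_ne_zero`).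

The partition comes from the linear case of Edmonds' matroid partition theorem
(`exists_indep_partition`): a finite family of vectors splits into `d` independent classes if
`|A| ≤ d * rank A` for every subfamily `A`. The vertex permutations act transitively on the
`r`-subsets and preserve the ranks of sets of boundaries, so it is enough to check the inequality
for the whole family (`card_le_mul_finrank_of_transitive`). There it reads
`n.choose r ≤ d * (n - 1).choose (r - 1)`, which is an equality; the rank is large enough because
the boundaries of the `r`-subsets through the last vertex are independent. The argument works over
every field, since neither scalars nor vectors have to be generic.

The third claim follows, as `detS` factors through the quotient.
-/

/-! ### Partition of a family of vectors into linearly independent classes -/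

section Partition

variable {k W E : Type*} [Field k] [AddCommGroup W] [Module k W]

/-- A partial colouring of a family of vectors (`none` stands for "no colour") is independent if
each colour class is linearly independent. -/
def IndepColouring (k : Type*) {W E : Type*} [Field k] [AddCommGroup W] [Module k W] {d : ℕ}
    (u : E → W) (c : E → Option (Fin d)) : Prop :=
  ∀ i, LinearIndepOn k u {e | c e = some i}

/-- An independent partial colouring is optimal if it leaves as few vectors as possible
uncoloured. -/
def OptimalColouring (k : Type*) {W E : Type*} [Field k] [AddCommGroup W] [Module k W]
    [Fintype E] {d : ℕ} (u : E → W) (c : E → Option (Fin d)) : Prop :=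
  IndepColouring k u c ∧ ∀ c' : E → Option (Fin d), IndepColouring k u c' →
    (Finset.univ.filter fun e => c e = none).card ≤ (Finset.univ.filter fun e => c' e = none).card

/-- A swap gives the colour of some `f` to an uncoloured `e`, leaves `f` uncoloured, and keeps the
colouring independent. -/
def ColourSwap (k : Type*) {W E : Type*} [Field k] [AddCommGroup W] [Module k W] [DecidableEq E]
    {d : ℕ} (u : E → W) (c c' : E → Option (Fin d)) : Prop :=
  ∃ e f i, c e = none ∧ c f = some i ∧
    c' = Function.update (Function.update c e (some i)) f none ∧ IndepColouring k u c'

theorem OptimalColouring.colourSwap [Fintype E] [DecidableEq E] {d : ℕ} {u : E → W}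
    {c c' : E → Option (Fin d)} (hc : OptimalColouring k u c) (h : ColourSwap k u c c') :
    OptimalColouring k u c' := by
  obtain ⟨e, f, i, he, hf, rfl, hind⟩ := h
  refine ⟨hind, fun c'' hc'' => le_trans (le_of_eq ?_) (hc.2 c'' hc'')⟩
  have hef : e ≠ f := by rintro rfl; simp [he] at hf
  have : (Finset.univ.filter fun g =>
      Function.update (Function.update c e (some i)) f none g = none) =
      insert f ((Finset.univ.filter fun g => c g = none).erase e) := by
    ext g
    by_cases hgf : g = f
    · simp [hgf]
    · by_cases hge : g = e
      · subst hge; simp [hgf]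
      · simp [hgf, hge]
  rw [this, Finset.card_insert_of_notMem (by simp [hf]),
    Finset.card_erase_of_mem (by simp [he])]
  exact Nat.sub_add_cancel (Finset.card_pos.2 ⟨e, by simp [he]⟩)

/-- An uncoloured vector of an optimal colouring lies in the span of each colour class, and there
in the span of those vectors for which it can be swapped. -/
theorem OptimalColouring.mem_span [Fintype E] [DecidableEq E] {d : ℕ} {u : E → W}
    {c : E → Option (Fin d)} (hc : OptimalColouring k u c) {A : Set E}
    (hA : ∀ c' f, ColourSwap k u c c' → c' f = none → f ∈ A) {e : E} (he : c e = none)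
    (i : Fin d) : u e ∈ Submodule.span k (u '' ({g | c g = some i} ∩ A)) := by
  have hmem : u e ∈ Submodule.span k (u '' {g | c g = some i}) := by
    by_contra hnot
    -- Otherwise `e` could receive the colour `i`.
    have hind : IndepColouring k u (Function.update c e (some i)) := by
      intro j
      by_cases hj : j = i
      · subst hj
        refine ((hc.1 j).insert hnot).mono fun g hg => ?_
        by_cases hge : g = e
        · exact Or.inl hge
        · exact Or.inr (by simpa [hge] using hg)
      · refine (hc.1 j).mono fun g hg => ?_
        by_cases hge : g = e
        · subst hge; simp [Ne.symm hj] at hg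
        · simpa [hge] using hg
    refine absurd (hc.2 _ hind) (not_le.2 (Finset.card_lt_card ?_))
    refine (Finset.ssubset_iff_of_subset fun g hg => ?_).2 ⟨e, by simp [he], by simp⟩
    by_cases hge : g = e
    · subst hge; simp [he]
    · simpa [hge] using hg
  obtain ⟨l, hl, hle⟩ := (Finsupp.mem_span_image_iff_linearCombination k).1 hmem
  refine (Finsupp.mem_span_image_iff_linearCombination k).2 ⟨l, ?_, hle⟩
  rw [Finsupp.mem_supported] at hl ⊢
  intro f hf
  have hfi : c f = some i := hl hf
  have hef : e ≠ f := by rintro rfl; simp [he] at hfi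
  have hnot : u e ∉ Submodule.span k (u '' ({g | c g = some i} \ {f})) := by
    intro h
    obtain ⟨l', hl', hle'⟩ := (Finsupp.mem_span_image_iff_linearCombination k).1 h
    rw [Finsupp.mem_supported] at hl'
    have h0 := linearIndepOn_iff.1 (hc.1 i) (l - l')
      (Submodule.sub_mem _ ((Finsupp.mem_supported _ _).2 hl)
        ((Finsupp.mem_supported _ _).2 fun x hx => (hl' hx).1)) (by simp [hle, hle'])
    have h1 : l' f = 0 := by
      by_contra h
      exact (hl' (Finsupp.mem_support_iff.2 h)).2 rfl
    have h2 : l f = l' f := by rw [sub_eq_zero.1 h0]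
    exact Finsupp.mem_support_iff.1 hf (h2.trans h1)
  refine ⟨hfi, hA (Function.update (Function.update c e (some i)) f none) f
    ⟨e, f, i, he, hfi, rfl, fun j => ?_⟩ (by simp)⟩
  by_cases hj : j = i
  · subst hj
    refine (((hc.1 j).mono Set.sdiff_subset).insert hnot).mono fun g hg => ?_
    by_cases hgf : g = f
    · subst hgf; simp at hg
    · by_cases hge : g = e
      · exact Or.inl hge
      · exact Or.inr ⟨by simpa [hge, hgf] using hg, hgf⟩
  · refine (hc.1 j).mono fun g hg => ?_
    by_cases hgf : g = f
    · subst hgf; simp at hg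
    · by_cases hge : g = e
      · subst hge; simp [hgf, Ne.symm hj] at hg
      · simpa [hge, hgf] using hg

/-- **Matroid partition** for vectors: if `|A| ≤ d * rank A` for all sets `A` of vectors of a finite
family, then the family is a union of `d` linearly independent classes. -/
theorem exists_indep_partition [Fintype E] [DecidableEq E] {d : ℕ} (u : E → W)
    (h : ∀ A : Finset E,
      A.card ≤ d * Module.finrank k (Submodule.span k (u '' (A : Set E)))) :
    ∃ c : E → Fin d, ∀ i, LinearIndepOn k u {e | c e = i} := by
  classical
  obtain ⟨c, hc⟩ : ∃ c : E → Option (Fin d), OptimalColouring k u c := by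
    obtain ⟨c, hc, hmin⟩ := Finset.exists_min_image
      (Finset.univ.filter fun c : E → Option (Fin d) => IndepColouring k u c)
      (fun c => (Finset.univ.filter fun e => c e = none).card)
      ⟨fun _ => none, Finset.mem_filter.2 ⟨Finset.mem_univ _, fun i => by simp⟩⟩
    exact ⟨c, (Finset.mem_filter.1 hc).2, fun c' hc' => hmin c' (by simp [hc'])⟩
  have hopt : ∀ c', Relation.ReflTransGen (ColourSwap k u) c c' → OptimalColouring k u c' := by
    intro c' hr
    induction hr with
    | refl => exact hc
    | tail _ hs ih => exact ih.colourSwap hs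
  -- `A` consists of the vectors left uncoloured by some colouring that swaps can reach. Swaps
  -- do not enlarge the span of the part of a colour class inside `A`, so for the colouring `c`
  -- that part of each class spans all of `A`.
  set A : Finset E := Finset.univ.filter fun g =>
    ∃ c', Relation.ReflTransGen (ColourSwap k u) c c' ∧ c' g = none with hAdef
  have hstep : ∀ c', Relation.ReflTransGen (ColourSwap k u) c c' → ∀ e, c' e = none → ∀ i,
      u e ∈ Submodule.span k (u '' ({g | c' g = some i} ∩ A)) := fun c' hr e he i =>
    (hopt c' hr).mem_span (fun c'' f hs hf => by
      simpa [hAdef] using ⟨c'', hr.tail hs, hf⟩) he i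
  have hspan : ∀ c', Relation.ReflTransGen (ColourSwap k u) c c' → ∀ i,
      Submodule.span k (u '' ({g | c' g = some i} ∩ A)) ≤
        Submodule.span k (u '' ({g | c g = some i} ∩ A)) := by
    intro c' hr
    induction hr with
    | refl => exact fun i => le_rfl
    | @tail c₁ c₂ hr hs ih =>
      intro i
      refine le_trans ?_ (ih i)
      obtain ⟨e, f, j, he, hf, rfl, -⟩ := hs
      rw [Submodule.span_le]
      rintro _ ⟨g, ⟨hg, hgA⟩, rfl⟩
      by_cases hgf : g = f
      · subst hgf; simp at hg
      · by_cases hge : g = e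
        · subst hge
          exact hstep _ hr _ he i
        · exact Submodule.subset_span ⟨g, ⟨by simpa [hgf, hge] using hg, hgA⟩, rfl⟩
  have hcol : ∀ e, c e ≠ none := by
    intro e he
    set B : Fin d → Finset E := fun i => A.filter fun g => c g = some i with hB
    have hrank : ∀ i, Module.finrank k (Submodule.span k (u '' (A : Set E))) ≤ (B i).card := by
      intro i
      have hle : Submodule.span k (u '' (A : Set E)) ≤
          Submodule.span k (((B i).image u : Finset W) : Set W) := by
        rw [Submodule.span_le]
        rintro _ ⟨g, hg, rfl⟩
        obtain ⟨c', hr, hg'⟩ := (Finset.mem_filter.1 (Finset.mem_coe.1 hg)).2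
        have := hspan c' hr i (hstep c' hr g hg' i)
        refine Submodule.span_mono ?_ this
        rintro _ ⟨x, ⟨hx, hxA⟩, rfl⟩
        exact Finset.mem_coe.2 (Finset.mem_image_of_mem u (Finset.mem_filter.2 ⟨hxA, hx⟩))
      exact (Submodule.finrank_mono hle).trans
        ((finrank_span_finset_le_card _).trans Finset.card_image_le)
    have hsum : ∑ i, (B i).card < A.card := by
      rw [← Finset.card_biUnion]
      · refine Finset.card_lt_card ((Finset.ssubset_iff_of_subset fun g hg => ?_).2 ⟨e, ?_, ?_⟩)
        · obtain ⟨i, -, hi⟩ := Finset.mem_biUnion.1 hg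
          exact (Finset.mem_filter.1 hi).1
        · simpa [hAdef] using ⟨c, Relation.ReflTransGen.refl, he⟩
        · simp [hB, he]
      · intro i _ j _ hij
        refine Finset.disjoint_left.2 fun g hi hj => hij ?_
        have h1 := (Finset.mem_filter.1 hi).2
        have h2 := (Finset.mem_filter.1 hj).2
        exact Option.some.inj (h1.symm.trans h2)
    have := Finset.sum_le_sum fun i (_ : i ∈ Finset.univ) => hrank i
    rw [Finset.sum_const, Finset.card_univ, Fintype.card_fin, smul_eq_mul] at this
    exact absurd (h A) (not_le.2 (this.trans_lt hsum))
  refine ⟨fun e => (c e).get (Option.isSome_iff_ne_none.2 (hcol e)), fun i => ?_⟩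
  refine (hc.1 i).mono fun e he => ?_
  change c e = some i
  rw [← show _ = i from he, Option.some_get]

/-- A finite family of vectors with a transitive group of symmetries is uniformly dense: if
`|A| ≤ d * rank A` holds for the whole family, then it holds for each subset `A`. A largest
minimizer of the submodular function `d * rank A - |A|` is invariant under the symmetries, hence
empty or the whole family. -/
theorem card_le_mul_finrank_of_transitive [FiniteDimensional k W] [Fintype E] [DecidableEq E]
    {d : ℕ} (u : E → W)
    (hE : Fintype.card E ≤ d * Module.finrank k (Submodule.span k (Set.range u)))
    (hsymm : ∀ x y : E, ∃ σ : Equiv.Perm E, σ x = y ∧ ∀ A : Finset E,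
      Module.finrank k (Submodule.span k (u '' (A.map σ.toEmbedding : Set E))) ≤
        Module.finrank k (Submodule.span k (u '' (A : Set E)))) (A : Finset E) :
    A.card ≤ d * Module.finrank k (Submodule.span k (u '' (A : Set E))) := by
  set ρ : Finset E → ℕ := fun A => Module.finrank k (Submodule.span k (u '' (A : Set E))) with hρ
  have hsub : ∀ A B, ρ (A ∪ B) + ρ (A ∩ B) ≤ ρ A + ρ B := by
    intro A B
    simp only [hρ]
    rw [← Submodule.finrank_sup_add_finrank_inf_eq (Submodule.span k (u '' (A : Set E)))
      (Submodule.span k (u '' (B : Set E))), Finset.coe_union, Set.image_union,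
      Submodule.span_union]
    refine Nat.add_le_add_left ?_ _
    apply Submodule.finrank_mono
    refine le_inf ?_ ?_ <;>
      exact Submodule.span_mono (Set.image_mono (by simp))
  set f : Finset E → ℤ := fun A => d * ρ A - A.card with hf
  have hfsub : ∀ A B, f (A ∪ B) + f (A ∩ B) ≤ f A + f B := by
    intro A B
    have h1 : (A ∪ B).card + (A ∩ B).card = A.card + B.card := Finset.card_union_add_card_inter A B
    have h2 := Nat.mul_le_mul_left d (hsub A B)
    simp only [hf]
    zify at h1 h2
    linarith
  obtain ⟨M, -, hM⟩ := Finset.exists_min_image Finset.univ f ⟨∅, Finset.mem_univ _⟩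
  obtain ⟨B, hB, hBmax⟩ := Finset.exists_max_image (Finset.univ.filter fun B => f B = f M)
    Finset.card ⟨M, by simp⟩
  have hBM : f B = f M := (Finset.mem_filter.1 hB).2
  have hinv : ∀ σ : Equiv.Perm E, (∀ A : Finset E, ρ (A.map σ.toEmbedding) ≤ ρ A) →
      B.map σ.toEmbedding ⊆ B := by
    intro σ hσ
    have h1 := hfsub B (B.map σ.toEmbedding)
    have h2 : f (B.map σ.toEmbedding) ≤ f B := by
      simp only [hf, Finset.card_map]
      have := Nat.mul_le_mul_left d (hσ B)
      zify at this
      linarith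
    have h3 := hM (B ∩ B.map σ.toEmbedding) (Finset.mem_univ _)
    have h4 := hM (B ∪ B.map σ.toEmbedding) (Finset.mem_univ _)
    have h5 := hBmax (B ∪ B.map σ.toEmbedding)
      (Finset.mem_filter.2 ⟨Finset.mem_univ _, by linarith⟩)
    have h6 := Finset.eq_of_subset_of_card_le Finset.subset_union_left h5
    exact Finset.subset_union_right.trans h6.ge
  have hnonneg : 0 ≤ f B := by
    rcases B.eq_empty_or_nonempty with h | ⟨x, hx⟩
    · simp only [h, hf, Finset.card_empty, Nat.cast_zero, sub_zero]
      positivity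
    · have : B = Finset.univ := by
        refine Finset.eq_univ_of_forall fun y => ?_
        obtain ⟨σ, rfl, hσ⟩ := hsymm x y
        exact hinv σ hσ (Finset.mem_map.2 ⟨x, hx, rfl⟩)
      have hu : ρ Finset.univ = Module.finrank k (Submodule.span k (Set.range u)) := by
        simp only [hρ]
        rw [Finset.coe_univ, Set.image_univ]
      rw [← hu] at hE
      zify at hE
      simp only [this, hf, Finset.card_univ]
      linarith
  have := hM A (Finset.mem_univ _)
  have h0 : 0 ≤ f A := by linarith
  simp only [hf] at h0
  zify
  linarith

end Partition

/-! ### The simplicial boundary -/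

namespace DetSr

section Boundary

variable (k : Type*) [Field k] {n : ℕ}

theorem boundaryCoeff_insert {F : Finset (Fin n)} {i : Fin n} (hi : i ∉ F) :
    boundaryCoeff k (insert i F) F = ∏ j ∈ F, if j < i then -1 else 1 := by
  rw [boundaryCoeff, Finset.sum_eq_single i]
  · rw [if_pos (Finset.erase_insert hi), Finset.filter_insert, if_neg (lt_irrefl i),
      Finset.prod_ite, Finset.prod_const, Finset.prod_const_one, mul_one]
  · intro j hj hji
    refine if_neg fun h => hi ?_
    rw [← h]
    simp [Ne.symm hji]
  · simp

theorem boundaryCoeff_insert_ne_zero {F : Finset (Fin n)} {i : Fin n} (hi : i ∉ F) :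
    boundaryCoeff k (insert i F) F ≠ 0 := by
  rw [boundaryCoeff_insert k hi, Finset.prod_ne_zero_iff]
  intro j _
  split_ifs <;> simp

variable {k} in
theorem exists_insert_of_boundaryCoeff_ne_zero {I F : Finset (Fin n)}
    (h : boundaryCoeff k I F ≠ 0) : ∃ i ∉ F, I = insert i F := by
  obtain ⟨i, hi, h⟩ := Finset.exists_ne_zero_of_sum_ne_zero h
  obtain rfl : I.erase i = F := by
    by_contra h'
    exact h (if_neg h')
  exact ⟨i, Finset.notMem_erase i I, (Finset.insert_erase hi).symm⟩

theorem sum_boundaryCoeff_mul (X : Finset (Fin n)) (g : Finset (Fin n) → k) :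
    ∑ I, boundaryCoeff k X I * g I =
      ∑ i ∈ X, (-1) ^ (X.filter (· < i)).card * g (X.erase i) := by
  simp only [boundaryCoeff, Finset.sum_mul]
  rw [Finset.sum_comm]
  refine Finset.sum_congr rfl fun i _ => ?_
  simp [ite_mul]

/-- `∂ ∘ ∂ = 0`. -/
theorem boundaryCoeff_comp (X G : Finset (Fin n)) :
    ∑ F, boundaryCoeff k X F * boundaryCoeff k F G = 0 := by
  rw [sum_boundaryCoeff_mul]
  simp only [boundaryCoeff, Finset.mul_sum]
  rw [Finset.sum_sigma']
  refine Finset.sum_involution (fun p _ => ⟨p.2, p.1⟩) ?_ ?_ ?_ ?_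
  · rintro ⟨i, j⟩ hp
    obtain ⟨hi, hji, hj⟩ : i ∈ X ∧ j ≠ i ∧ j ∈ X := by simpa using hp
    simp only [Finset.erase_right_comm (a := i) (b := j)]
    split_ifs with h
    · rcases lt_or_gt_of_ne hji with hlt | hlt
      · have h1 : (X.erase j).filter (· < i) = (X.filter (· < i)).erase j := by
          rw [Finset.filter_erase]
        have h2 : (X.erase i).filter (· < j) = X.filter (· < j) := by
          rw [Finset.filter_erase, Finset.erase_eq_of_notMem (by simp [hlt.le])]
        have h3 : ((X.filter (· < i)).erase j).card + 1 = (X.filter (· < i)).card :=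
          Finset.card_erase_add_one (by simp [hj, hlt])
        rw [h1, h2, ← h3]
        ring
      · have h1 : (X.erase i).filter (· < j) = (X.filter (· < j)).erase i := by
          rw [Finset.filter_erase]
        have h2 : (X.erase j).filter (· < i) = X.filter (· < i) := by
          rw [Finset.filter_erase, Finset.erase_eq_of_notMem (by simp [hlt.le])]
        have h3 : ((X.filter (· < j)).erase i).card + 1 = (X.filter (· < j)).card :=
          Finset.card_erase_add_one (by simp [hi, hlt])
        rw [h1, h2, ← h3]
        ring
    · simp
  · rintro ⟨i, j⟩ hp _ heq
    obtain ⟨hi, hji, hj⟩ : i ∈ X ∧ j ≠ i ∧ j ∈ X := by simpa using hp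
    simp only [Sigma.mk.injEq] at heq
    exact hji heq.1
  · rintro ⟨i, j⟩ hp
    obtain ⟨hi, hji, hj⟩ : i ∈ X ∧ j ≠ i ∧ j ∈ X := by simpa using hp
    simpa using ⟨hj, Ne.symm hji, hi⟩
  · rintro ⟨i, j⟩ _
    rfl

/-- A cycle supported on the faces through a fixed vertex `x` vanishes: the coefficient of the
boundary of `z` at `F.erase x` is, up to sign, the coefficient of `z` at `F`. -/
theorem eq_zero_of_cycle (x : Fin n) (z : Finset (Fin n) → k)
    (hz : ∀ G, ∑ F, z F * boundaryCoeff k F G = 0) (hx : ∀ F, x ∉ F → z F = 0) : z = 0 := by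
  funext F
  by_cases hF : x ∈ F
  · have h := hz (F.erase x)
    rw [Finset.sum_eq_single F] at h
    · have := boundaryCoeff_insert_ne_zero k (Finset.notMem_erase x F)
      rw [Finset.insert_erase hF] at this
      exact (mul_eq_zero.1 h).resolve_right this
    · intro F' _ hne
      by_contra hne0
      obtain ⟨hz', hb⟩ := mul_ne_zero_iff.1 hne0
      obtain ⟨j, -, rfl⟩ := exists_insert_of_boundaryCoeff_ne_zero hb
      have hmem : x ∈ insert j (F.erase x) := by
        by_contra h'
        exact hz' (hx _ h')
      obtain rfl : x = j := by simpa using hmem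
      exact hne (Finset.insert_erase hF)
    · simp
  · exact hx F hF

/-! ### The action of permutations of the vertices -/

/-- `-1` if the permutation `σ` reverses the order of `i` and `j`, and `1` otherwise. -/
def inversionSign (σ : Equiv.Perm (Fin n)) (i j : Fin n) : k :=
  (if j < i then -1 else 1) * (if σ j < σ i then -1 else 1)

/-- The sign with which the permutation `σ` of the vertices maps the oriented simplex on `I` to the
oriented simplex on `σ(I)`. -/
def orientationSign (σ : Equiv.Perm (Fin n)) (I : Finset (Fin n)) : k :=
  ∏ i ∈ I, ∏ j ∈ I with j < i, inversionSign k σ i j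

theorem inversionSign_comm (σ : Equiv.Perm (Fin n)) {i j : Fin n} (h : i ≠ j) :
    inversionSign k σ i j = inversionSign k σ j i := by
  have h' : σ i ≠ σ j := σ.injective.ne h
  unfold inversionSign
  rcases lt_or_gt_of_ne h with h1 | h1 <;> rcases lt_or_gt_of_ne h' with h2 | h2 <;>
    simp [h1, h2, h1.le, h2.le, not_lt.2]

theorem orientationSign_insert (σ : Equiv.Perm (Fin n)) {F : Finset (Fin n)} {i : Fin n}
    (hi : i ∉ F) : orientationSign k σ (insert i F) =
      orientationSign k σ F * ∏ j ∈ F, inversionSign k σ i j := by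
  have h1 : ∀ j ∈ F, (∏ l ∈ insert i F with l < j, inversionSign k σ j l) =
      (if i < j then inversionSign k σ i j else 1) *
        ∏ l ∈ F with l < j, inversionSign k σ j l := by
    intro j hj
    have hij : i ≠ j := fun h => hi (h ▸ hj)
    rw [Finset.filter_insert]
    split_ifs with h
    · rw [Finset.prod_insert (by simp [hi]), inversionSign_comm k σ hij]
    · rw [one_mul]
  rw [orientationSign, Finset.prod_insert hi, Finset.prod_congr rfl h1, Finset.prod_mul_distrib,
    Finset.filter_insert, if_neg (lt_irrefl i), Finset.prod_filter, ← mul_assoc,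
    ← Finset.prod_mul_distrib, mul_comm, orientationSign]
  congr 1
  refine Finset.prod_congr rfl fun j hj => ?_
  have hij : i ≠ j := fun h => hi (h ▸ hj)
  rcases lt_or_gt_of_ne hij with h | h <;> simp [h, h.le, not_lt.2]

theorem orientationSign_mul_self (σ : Equiv.Perm (Fin n)) (I : Finset (Fin n)) :
    orientationSign k σ I * orientationSign k σ I = 1 := by
  simp only [orientationSign, ← Finset.prod_mul_distrib]
  refine Finset.prod_eq_one fun i _ => Finset.prod_eq_one fun j _ => ?_
  unfold inversionSign
  split_ifs <;> simp

theorem boundaryCoeff_map (σ : Equiv.Perm (Fin n)) (I F : Finset (Fin n)) :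
    boundaryCoeff k (I.map σ.toEmbedding) (F.map σ.toEmbedding) =
      orientationSign k σ I * orientationSign k σ F * boundaryCoeff k I F := by
  by_cases h : ∃ i ∉ F, I = insert i F
  · obtain ⟨i, hi, rfl⟩ := h
    have hi' : σ i ∉ F.map σ.toEmbedding := by simpa using hi
    rw [Finset.map_insert, Equiv.coe_toEmbedding, boundaryCoeff_insert k hi',
      boundaryCoeff_insert k hi, orientationSign_insert k σ hi, Finset.prod_map,
      mul_right_comm (orientationSign k σ F), orientationSign_mul_self, one_mul,
      ← Finset.prod_mul_distrib]
    refine Finset.prod_congr rfl fun j _ => ?_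
    unfold inversionSign
    simp only [Equiv.coe_toEmbedding]
    split_ifs <;> simp
  · have h1 : boundaryCoeff k I F = 0 := by
      by_contra h'
      exact h (exists_insert_of_boundaryCoeff_ne_zero h')
    rw [h1, mul_zero]
    by_contra h'
    obtain ⟨i, hi, hI⟩ := exists_insert_of_boundaryCoeff_ne_zero h'
    refine h ⟨σ.symm i, fun hm => hi (Finset.mem_map.2 ⟨_, hm, by simp⟩), ?_⟩
    apply Finset.map_injective σ.toEmbedding
    rw [hI, Finset.map_insert]
    simp

/-- The boundary of a hyperedge, as a function on all sets of vertices. -/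
def boundary {r : ℕ} (I : Hyperedge n r) : Finset (Fin n) → k := boundaryCoeff k I.1

/-- The permutation of the hyperedges induced by a permutation of the vertices. -/
def hyperedgePerm {r : ℕ} (σ : Equiv.Perm (Fin n)) : Equiv.Perm (Hyperedge n r) :=
  σ.finsetCongr.subtypeEquiv fun I => by simp [Equiv.finsetCongr_apply]

theorem exists_hyperedgePerm_eq {r : ℕ} (I J : Hyperedge n r) :
    ∃ σ : Equiv.Perm (Fin n), hyperedgePerm σ I = J := by
  have e : {x // x ∈ I.1} ≃ {x // x ∈ J.1} := Finset.equivOfCardEq (I.2.trans J.2.symm)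
  refine ⟨e.extendSubtype, Subtype.ext ?_⟩
  change I.1.map _ = J.1
  refine Finset.eq_of_subset_of_card_le (fun x hx => ?_) (by simp [I.2, J.2])
  obtain ⟨y, hy, rfl⟩ := Finset.mem_map.1 hx
  exact e.extendSubtype_mem y hy

/-- A permutation of the vertices acts on the boundaries by a linear map, up to signs, and so does
not increase the rank of a set of boundaries. -/
theorem finrank_span_boundary_map_le {r : ℕ} (σ : Equiv.Perm (Fin n))
    (A : Finset (Hyperedge n r)) :
    Module.finrank k (Submodule.span k
      (boundary k '' (A.map (hyperedgePerm σ).toEmbedding : Set (Hyperedge n r)))) ≤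
    Module.finrank k (Submodule.span k (boundary k '' (A : Set (Hyperedge n r)))) := by
  set L : (Finset (Fin n) → k) →ₗ[k] (Finset (Fin n) → k) :=
    LinearMap.pi fun F => orientationSign k σ (F.map σ.symm.toEmbedding) •
      LinearMap.proj (F.map σ.symm.toEmbedding) with hL
  refine le_trans (Submodule.finrank_mono (t := (Submodule.span k
    (boundary k '' (A : Set (Hyperedge n r)))).map L) ?_) (Submodule.finrank_map_le _ _)
  rw [Submodule.span_le]
  rintro _ ⟨_, hJ, rfl⟩
  obtain ⟨I, hI, rfl⟩ := Finset.mem_map.1 (Finset.mem_coe.1 hJ)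
  have key : boundary k (hyperedgePerm σ I) = orientationSign k σ I.1 • L (boundary k I) := by
    funext F
    obtain ⟨G, rfl⟩ : ∃ G : Finset (Fin n), F = G.map σ.toEmbedding :=
      ⟨F.map σ.symm.toEmbedding, by simp [Finset.map_map]⟩
    have hG : (G.map σ.toEmbedding).map σ.symm.toEmbedding = G := by simp [Finset.map_map]
    have : boundary k (hyperedgePerm σ I) (G.map σ.toEmbedding) =
        boundaryCoeff k (I.1.map σ.toEmbedding) (G.map σ.toEmbedding) := rfl
    rw [this, boundaryCoeff_map]
    simp only [hL, Pi.smul_apply, LinearMap.pi_apply, LinearMap.smul_apply, hG, smul_eq_mul,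
      LinearMap.proj_apply, boundary]
    ring
  change boundary k (hyperedgePerm σ I) ∈ _
  rw [key]
  exact Submodule.smul_mem _ _ (Submodule.mem_map_of_mem (Submodule.subset_span ⟨I, hI, rfl⟩))

end Boundary
end DetSr

/-! ### The linear system -/

namespace DetSr

section System

theorem sum_hyperedge {M : Type*} [AddCommMonoid M] {n s : ℕ} (g : Finset (Fin n) → M)
    (hg : ∀ I, g I ≠ 0 → I.card = s) : ∑ I : Hyperedge n s, g I.1 = ∑ I, g I := by
  rw [← Finset.sum_subtype (Finset.univ.filter fun I : Finset (Fin n) => I.card = s) (by simp) g]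
  exact Finset.sum_filter_of_ne fun I _ => hg I

theorem liftFace_injective {n s : ℕ} :
    Function.Injective (liftFace : Hyperedge (n - 1) s → Finset (Fin n)) := fun _ _ h =>
  Subtype.ext (Finset.map_injective _ h)

theorem last_notMem_liftFace {n s : ℕ} {x : Fin n} (hx : (x : ℕ) = n - 1)
    (F : Hyperedge (n - 1) s) : x ∉ liftFace F := by
  intro h
  obtain ⟨y, -, rfl⟩ := Finset.mem_map.1 h
  exact absurd hx y.2.ne

theorem exists_liftFace_eq {n s : ℕ} {x : Fin n} (hx : (x : ℕ) = n - 1) {F : Finset (Fin n)}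
    (hF : F.card = s) (hxF : x ∉ F) : ∃ F' : Hyperedge (n - 1) s, liftFace F' = F := by
  obtain ⟨T, rfl⟩ : ∃ T : Finset (Fin (n - 1)), T.map (Fin.castLEEmb (Nat.sub_le n 1)) = F := by
    refine ⟨F.preimage (Fin.castLEEmb (Nat.sub_le n 1)) (Fin.castLEEmb _).injective.injOn, ?_⟩
    ext y
    simp only [Finset.mem_map, Finset.mem_preimage]
    refine ⟨?_, fun hy => ?_⟩
    · rintro ⟨z, hz, rfl⟩
      exact hz
    · have hne : (y : ℕ) ≠ n - 1 := fun h => hxF (Fin.ext (hx.trans h.symm) ▸ hy)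
      exact ⟨⟨y, by omega⟩, hy, rfl⟩
  exact ⟨⟨T, by simpa using hF⟩, rfl⟩

variable (k : Type*) [Field k]

/-- The boundaries of the hyperedges through the last vertex are linearly independent. -/
theorem choose_le_finrank_span_boundary {n r : ℕ} (hr : 1 ≤ r) (hn : 1 ≤ n) :
    (n - 1).choose (r - 1) ≤
      Module.finrank k (Submodule.span k (Set.range (boundary k : Hyperedge n r → _))) := by
  obtain ⟨x, hx⟩ : ∃ x : Fin n, (x : ℕ) = n - 1 := ⟨⟨n - 1, by omega⟩, rfl⟩
  set cone : Hyperedge (n - 1) (r - 1) → Hyperedge n r := fun F =>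
    ⟨insert x (liftFace F), by
      rw [Finset.card_insert_of_notMem (last_notMem_liftFace hx F), liftFace, Finset.card_map, F.2]
      omega⟩ with hcone
  have hind : LinearIndependent k fun F => boundary k (cone F) := by
    rw [Fintype.linearIndependent_iff]
    intro g hg G
    have h := congrFun hg (liftFace G)
    rw [Finset.sum_apply, Finset.sum_eq_single G] at h
    · exact (mul_eq_zero.1 h).resolve_right
        (boundaryCoeff_insert_ne_zero k (last_notMem_liftFace hx G))
    · intro F _ hFG
      by_contra hne
      have hb : boundaryCoeff k (insert x (liftFace F)) (liftFace G) ≠ 0 :=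
        (mul_ne_zero_iff.1 hne).2
      obtain ⟨i, hi, heq⟩ := exists_insert_of_boundaryCoeff_ne_zero hb
      obtain rfl : x = i := by
        have : x ∈ insert i (liftFace G) := heq ▸ Finset.mem_insert_self _ _
        exact (Finset.mem_insert.1 this).resolve_right (last_notMem_liftFace hx G)
      refine hFG (liftFace_injective ?_)
      rw [← Finset.erase_insert (last_notMem_liftFace hx F), heq, Finset.erase_insert hi]
    · simp
  rw [← card_hyperedge, ← finrank_span_eq_card hind]
  refine Submodule.finrank_mono (Submodule.span_mono ?_)
  rintro _ ⟨F, rfl⟩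
  exact ⟨cone F, rfl⟩

/-- The equations of the faces that avoid the last vertex imply those of all other faces. -/
theorem sum_smul_boundary_eq_zero {n r : ℕ} (hr : 1 ≤ r) (hn : 1 ≤ n) (l : Hyperedge n r → k)
    (h : ∀ F : Hyperedge (n - 1) (r - 1), ∑ I, l I * boundaryCoeff k I.1 (liftFace F) = 0) :
    ∑ I, l I • boundary k I = 0 := by
  obtain ⟨x, hx⟩ : ∃ x : Fin n, (x : ℕ) = n - 1 := ⟨⟨n - 1, by omega⟩, rfl⟩
  refine eq_zero_of_cycle k x _ (fun G => ?_) (fun F hF => ?_)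
  · simp only [Finset.sum_apply, Pi.smul_apply, smul_eq_mul, boundary, Finset.sum_mul]
    rw [Finset.sum_comm]
    refine Finset.sum_eq_zero fun I _ => ?_
    simp only [mul_assoc]
    rw [← Finset.mul_sum, boundaryCoeff_comp, mul_zero]
  · simp only [Finset.sum_apply, Pi.smul_apply, smul_eq_mul, boundary]
    by_cases hcard : F.card = r - 1
    · obtain ⟨F, rfl⟩ := exists_liftFace_eq hx hcard hF
      exact h F
    · refine Finset.sum_eq_zero fun I _ => ?_
      by_contra hne
      obtain ⟨i, hi, hI⟩ := exists_insert_of_boundaryCoeff_ne_zero (mul_ne_zero_iff.1 hne).2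
      have := I.2
      rw [hI, Finset.card_insert_of_notMem hi] at this
      omega

/-- The hyperedges on `r * d` vertices can be partitioned into `d` classes whose boundaries are
linearly independent. -/
theorem exists_indep_hyperedge_partition {r d : ℕ} (hr : 1 ≤ r) (hd : 1 ≤ d) :
    ∃ c : Hyperedge (r * d) r → Fin d, ∀ i, LinearIndepOn k (boundary k) {I | c I = i} := by
  refine exists_indep_partition _ (card_le_mul_finrank_of_transitive _ ?_ fun I J => ?_)
  · rw [card_hyperedge, ← choose_eq hr, mul_comm]
    exact Nat.mul_le_mul_left d (choose_le_finrank_span_boundary k hr (Nat.mul_pos hr hd))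
  · obtain ⟨σ, hσ⟩ := exists_hyperedgePerm_eq I J
    exact ⟨hyperedgePerm σ, hσ, finrank_span_boundary_map_le k σ⟩

variable {k} {V : Type*} [AddCommGroup V] [Module k V] {r d : ℕ} (hr : 1 ≤ r)
  (b : Module.Basis (Fin d) k V)

theorem detS_tprod_eq_zero_iff (v : Hyperedge (r * d) r → V) :
    detS hr b (PiTensorProduct.tprod k v) = 0 ↔ ∃ l : Hyperedge (r * d) r → k, l ≠ 0 ∧
      ∀ (F : Hyperedge (r * d - 1) (r - 1)) (j : Fin d),
        ∑ I, boundaryCoeff k I.1 (liftFace F) * b.repr (v I) j * l I = 0 := by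
  rw [detS_tprod, ← Matrix.exists_mulVec_eq_zero_iff]
  refine exists_congr fun l => and_congr_right fun _ => ?_
  refine ⟨fun h F j => ?_, fun h => funext fun J => ?_⟩
  · simpa [Matrix.mulVec, dotProduct, systemMatrix] using
      congrFun h (equationEquiv d hr (F, j))
  · exact h ((equationEquiv d hr).symm J).1 ((equationEquiv d hr).symm J).2

/-- The boundary of a simplex `X` whose faces carry equal vectors solves the linear system. -/
theorem detS_tprod_eq_zero_of_hasConstantSimplex (v : Hyperedge (r * d) r → V)
    (hv : HasConstantSimplex v) : detS hr b (PiTensorProduct.tprod k v) = 0 := by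
  obtain ⟨X, hX, hconst⟩ := hv
  obtain ⟨x, hx⟩ := Finset.card_pos.1 (by omega : 0 < X.card)
  have hX' : insert x (X.erase x) = X := Finset.insert_erase hx
  set I₀ : Hyperedge (r * d) r := ⟨X.erase x, by rw [Finset.card_erase_of_mem hx]; omega⟩ with hI₀
  have hI₀X : I₀.1 ⊆ X := Finset.erase_subset x X
  refine (detS_tprod_eq_zero_iff hr b v).2 ⟨fun I => boundaryCoeff k X I.1, ?_, fun F j => ?_⟩
  · intro h
    have := boundaryCoeff_insert_ne_zero k (Finset.notMem_erase x X)
    rw [hX'] at this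
    exact this (congrFun h I₀)
  · have h1 : ∀ I : Hyperedge (r * d) r,
        boundaryCoeff k I.1 (liftFace F) * b.repr (v I) j * boundaryCoeff k X I.1 =
          boundaryCoeff k X I.1 * boundaryCoeff k I.1 (liftFace F) * b.repr (v I₀) j := by
      intro I
      by_cases h0 : boundaryCoeff k X I.1 = 0
      · simp [h0]
      · obtain ⟨i, -, hi⟩ := exists_insert_of_boundaryCoeff_ne_zero h0
        rw [hconst I I₀ (hi ▸ Finset.subset_insert _ _) hI₀X]
        ring
    rw [Finset.sum_congr rfl fun I _ => h1 I, ← Finset.sum_mul,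
      sum_hyperedge (fun I => boundaryCoeff k X I * boundaryCoeff k I (liftFace F)),
      boundaryCoeff_comp, zero_mul]
    intro I hI
    obtain ⟨i, hi, hXi⟩ := exists_insert_of_boundaryCoeff_ne_zero (mul_ne_zero_iff.1 hI).1
    rw [hXi, Finset.card_insert_of_notMem hi] at hX
    omega

/-- If basis vectors are attached to the hyperedges according to a partition into classes with
linearly independent boundaries, then the linear system splits into one system for each class,
and has only the zero solution. -/
theorem detS_tprod_basis_ne_zero (hd : 1 ≤ d) (c : Hyperedge (r * d) r → Fin d)
    (hc : ∀ i, LinearIndepOn k (boundary k) {I | c I = i}) :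
    detS hr b (PiTensorProduct.tprod k fun I => b (c I)) ≠ 0 := by
  intro h0
  obtain ⟨l, hl, h⟩ := (detS_tprod_eq_zero_iff hr b _).1 h0
  refine hl (funext fun I₀ => ?_)
  have hsum := sum_smul_boundary_eq_zero k hr (Nat.mul_pos hr hd)
    (fun I => if c I = c I₀ then l I else 0) fun F => by
      refine (Finset.sum_congr rfl fun I _ => ?_).trans (h F (c I₀))
      rw [Module.Basis.repr_self, Finsupp.single_apply]
      split_ifs <;> ring
  have hI := hc (c I₀)
  rw [show {I | c I = c I₀} =
      ((Finset.univ.filter fun I => c I = c I₀ : Finset (Hyperedge (r * d) r)) : Set _) by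
    ext I; simp, linearIndepOn_finset_iff] at hI
  refine hI l ?_ I₀ (by simp)
  rw [Finset.sum_filter]
  refine (Finset.sum_congr rfl fun I _ => ?_).trans hsum
  split_ifs <;> simp

theorem detS_ne_zero (hd : 1 ≤ d) : detS hr b ≠ 0 := by
  intro h
  obtain ⟨c, hc⟩ := exists_indep_hyperedge_partition k hr hd
  exact detS_tprod_basis_ne_zero hr b hd c hc (by rw [h, LinearMap.zero_apply])

theorem relations_le_ker_detS : relations k V r (r * d) ≤ LinearMap.ker (detS hr b) := by
  rw [relations, Submodule.span_le]
  rintro _ ⟨v, hv, rfl⟩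
  exact detS_tprod_eq_zero_of_hasConstantSimplex hr b v hv

end System

end DetSr

theorem corollary5p2 {k V : Type*} [Field k] [AddCommGroup V] [Module k V]
    (r d : ℕ) (hr : 1 ≤ r) (hd : 1 ≤ d) (b : Module.Basis (Fin d) k V) :
    (∀ v : DetSr.Hyperedge (r * d) r → V, DetSr.HasConstantSimplex v →
      DetSr.detS hr b (PiTensorProduct.tprod k v) = 0) ∧
    DetSr.detS hr b ≠ 0 ∧
    1 ≤ Module.rank k (DetSr.ExteriorS k V r (r * d)) := by
  refine ⟨DetSr.detS_tprod_eq_zero_of_hasConstantSimplex hr b, DetSr.detS_ne_zero hr b hd, ?_⟩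
  have hne : DetSr.relations k V r (r * d) ≠ ⊤ := fun h =>
    DetSr.detS_ne_zero hr b hd
      (LinearMap.ker_eq_top.1 (top_le_iff.1 (h ▸ DetSr.relations_le_ker_detS hr b)))
  have : Nontrivial (DetSr.ExteriorS k V r (r * d)) := Submodule.Quotient.nontrivial_iff.2 hne
  exact Cardinal.one_le_iff_pos.2 rank_pos
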